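/- For $d\in\{2,3\}$, let $\operatorname{Arm}_d(n)$ be the space of $n$-edge polygons in $\mathbb{R}^d$ of total length $2$ up to translation, that is, of lists of edge vectors $e_1,\dots,e_n\in\mathbb{R}^d$ with $\sum_i|e_i|=2$, and let $\operatorname{Pol}_d(n)\subset\operatorname{Arm}_d(n)$ be the subspace of closed polygons, $\sum_i e_i=0$. For $0\le k\le n$ and a polygon $P=(e_1,\dots,e_n)$ let $\operatorname{Chord}(k,P)=\left|\sum_{i=1}^k e_i\right|^2$ be the squared length of the chord skipping the first $k$ edges. Let $\mathbb{H}$ be the quaternions, identify $\mathbb{R}^3$ with the imaginary quaternions and $\mathbb{R}^2$ with the plane $\mathbf{i}\oplus\mathbf{k}$ in it, and let $\operatorname{Hopf}(q)=\bar q\,\mathbf{i}\,q$, extended coordinatewise to $\mathbb{H}^n$. Identify $\mathbb{H}^n$ with $\mathbb{C}^n\times\mathbb{C}^n$ by $(a,b)\mapsto a+b\mathbf{j}$, and for $n \ge 2$ let $V_2(\mathbb{K}^n)$ be the Stiefel manifold of orthonormal $2$-frames $(a,b)$ in $\mathbb{K}^n$, for $\mathbb{K}=\mathbb{R}$ or $\mathbb{C}$.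 The symmetric measures are the probability measures obtained by pushing forward under $\operatorname{Hopf}$ the following measures, each normalized to total mass $1$: * on $\operatorname{Arm}_3(n)$, the surface measure of the sphere $S^{4n-1}\subset\mathbb{H}^n$ of radius $\sqrt2$; * on $\operatorname{Arm}_2(n)$, the surface measure of $S^{2n-1}\sqcup S^{2n-1}$, the disjoint union of the spheres of radius $\sqrt2$ in $(1\oplus\mathbf{j})^n$ and in $\mathbf{i}(1\oplus\mathbf{j})^n=(\mathbf{i}\oplus\mathbf{k})^n$; * on $\operatorname{Pol}_3(n)$, the Haar (that is, $U(n)$-invariant) measure of $V_2(\mathbb{C}^n)$; * on $\operatorname{Pol}_2(n)$, the Haar (that is, $O(n)$-invariant) measure of $V_2(\mathbb{R}^n)\sqcup\mathbf{i}V_2(\mathbb{R}^n)$, both pieces having equal mass. Then $\operatorname{Chord}(k)$ is integrable with respect to each of these measures. Its expected values are, for $n\ge1$ and $0\le k\le n$, $$E(\operatorname{Chord}(k),\operatorname{Arm}_3(n))=\frac{6k}{n(n+\frac12)},\qquad E(\operatorname{Chord}(k),\operatorname{Arm}_2(n))=\frac{8k}{n(n+1)},$$ and, for $n\ge2$ and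 $0\le k\le n$, $$E(\operatorname{Chord}(k),\operatorname{Pol}_3(n))=\frac{n-k}{n-1}\cdot\frac{6k}{n(n+1)},\qquad E(\operatorname{Chord}(k),\operatorname{Pol}_2(n))=\frac{n-k}{n-1}\cdot\frac{8k}{n(n+2)}.$$ -/

import Mathlib

open MeasureTheory
open scoped Quaternion ENNReal

noncomputable section

namespace RandomPolygon

/-! ### Polygons, up to translation, as lists of edge vectors -/

/-- `n`-edge polygonal arms of total length `2` in `ℝ^d`, up to translation. -/
abbrev Arm (d n : ℕ) : Type :=
  {e : Fin n → EuclideanSpace ℝ (Fin d) // ∑ i, ‖e i‖ = 2}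

/-- Closed `n`-edge polygons of total length `2` in `ℝ^d`, up to translation. -/
abbrev Pol (d n : ℕ) : Type :=
  {e : Fin n → EuclideanSpace ℝ (Fin d) // ∑ i, ‖e i‖ = 2 ∧ ∑ i, e i = 0}

/-- Squared length of the chord that skips the first `k` edges of the polygon with edge list `e`. -/
def chord {d n : ℕ} (k : ℕ) (e : Fin n → EuclideanSpace ℝ (Fin d)) : ℝ :=
  ‖∑ i with i.val < k, e i‖ ^ 2

/-! ### The Hopf map -/

/-- The quaternion unit `𝐢`. -/
def qI : ℍ[ℝ] := ⟨0, 1, 0, 0⟩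

/-- The quaternion unit `𝐣`. -/
def qJ : ℍ[ℝ] := ⟨0, 0, 1, 0⟩

/-- The Hopf map `q ↦ q̄ 𝐢 q`, whose values are purely imaginary quaternions. -/
def hopf (q : ℍ[ℝ]) : ℍ[ℝ] := star q * qI * q

/-- The imaginary part of a quaternion as a vector of `ℝ³`. -/
def imVec (w : ℍ[ℝ]) : EuclideanSpace ℝ (Fin 3) := !₂[w.imI, w.imJ, w.imK]

/-- The coordinates in `ℝ²` of a quaternion of the plane `𝐢 ⊕ 𝐤`. -/
def planeVec (w : ℍ[ℝ]) : EuclideanSpace ℝ (Fin 2) := !₂[w.imI, w.imK]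

/-- The quaternion `a + b 𝐣`, for complex numbers `a = a₀ + a₁ 𝐢` and `b = b₀ + b₁ 𝐢`. -/
def pairQuat (a b : ℂ) : ℍ[ℝ] := ⟨a.re, a.im, b.re, b.im⟩

theorem pairQuat_eq (a b : ℂ) : pairQuat a b = (a : ℍ[ℝ]) + (b : ℍ[ℝ]) * qJ := by
  ext <;> simp <;> simp [pairQuat, qJ]

theorem norm_sq_eq (q : ℍ[ℝ]) :
    ‖q‖ ^ 2 = q.re ^ 2 + q.imI ^ 2 + q.imJ ^ 2 + q.imK ^ 2 := by
  rw [sq ‖q‖, ← Quaternion.normSq_eq_norm_mul_self, Quaternion.normSq_def']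

theorem norm_sq_pairQuat (a b : ℂ) : ‖pairQuat a b‖ ^ 2 = ‖a‖ ^ 2 + ‖b‖ ^ 2 := by
  rw [norm_sq_eq, ← Complex.normSq_eq_norm_sq, ← Complex.normSq_eq_norm_sq,
    Complex.normSq_apply, Complex.normSq_apply]
  simp only [pairQuat]
  ring

theorem qI_mul_pairQuat (a b : ℂ) :
    qI * pairQuat a b = pairQuat (Complex.I * a) (Complex.I * b) := by
  ext <;> simp <;> simp [pairQuat, qI]

theorem hopf_eq (q : ℍ[ℝ]) : hopf q =
    ⟨0, q.re ^ 2 + q.imI ^ 2 - q.imJ ^ 2 - q.imK ^ 2,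
      2 * q.imI * q.imJ - 2 * q.re * q.imK, 2 * q.re * q.imJ + 2 * q.imI * q.imK⟩ := by
  ext <;> simp [hopf] <;> simp [qI] <;> ring

theorem norm_imVec_hopf (q : ℍ[ℝ]) : ‖imVec (hopf q)‖ = ‖q‖ ^ 2 := by
  rw [EuclideanSpace.norm_eq, Real.sqrt_eq_iff_eq_sq (by positivity) (by positivity), norm_sq_eq]
  simp [imVec, hopf_eq, Fin.sum_univ_three]
  ring

theorem imVec_hopf_pairQuat (a b : ℂ) : imVec (hopf (pairQuat a b)) =
    !₂[‖a‖ ^ 2 - ‖b‖ ^ 2, 2 * (a * star b).im, 2 * (a * star b).re] := by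
  rw [hopf_eq, ← Complex.normSq_eq_norm_sq, ← Complex.normSq_eq_norm_sq,
    Complex.normSq_apply, Complex.normSq_apply]
  ext j
  fin_cases j <;> simp [imVec, pairQuat] <;> ring

/-- The Hopf map sends the planes `1 ⊕ 𝐣` and `𝐢 ⊕ 𝐤` to the plane `𝐢 ⊕ 𝐤`. -/
theorem hopf_real (a b : ℝ) :
    hopf (pairQuat a b) = ⟨0, a ^ 2 - b ^ 2, 0, 2 * a * b⟩ := by
  rw [hopf_eq]
  ext <;> simp [pairQuat]

theorem hopf_imag (a b : ℝ) :
    hopf (qI * pairQuat a b) = ⟨0, a ^ 2 - b ^ 2, 0, 2 * a * b⟩ := by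
  rw [qI_mul_pairQuat, hopf_eq]
  ext <;> simp [pairQuat]

theorem norm_planeVec_hopf_real (a b : ℝ) :
    ‖planeVec (hopf (pairQuat a b))‖ = a ^ 2 + b ^ 2 := by
  rw [EuclideanSpace.norm_eq, Real.sqrt_eq_iff_eq_sq (by positivity) (by positivity), hopf_real]
  simp [planeVec]
  ring

theorem norm_planeVec_hopf_imag (a b : ℝ) :
    ‖planeVec (hopf (qI * pairQuat a b))‖ = a ^ 2 + b ^ 2 := by
  rw [EuclideanSpace.norm_eq, Real.sqrt_eq_iff_eq_sq (by positivity) (by positivity), hopf_imag]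
  simp [planeVec]
  ring

/-! ### Spheres of radius `√2` and symmetric measures on arm spaces -/

instance : MeasurableSpace ℍ[ℝ] := borel _

instance : BorelSpace ℍ[ℝ] := ⟨rfl⟩

section Sphere

variable (E : Type) [NormedAddCommGroup E] [InnerProductSpace ℝ E]

/-- The sphere of radius `√2`. -/
abbrev Sphere2 : Type := Metric.sphere (0 : E) (√2)

variable {E} in
/-- The homothety from the unit sphere onto the sphere of radius `√2`. -/
def dilate (x : Metric.sphere (0 : E) 1) : Sphere2 E :=
  ⟨√2 • (x : E), by simp [norm_smul]⟩

variable [FiniteDimensional ℝ E] [MeasurableSpace E] [BorelSpace E]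

/-- The surface measure of the sphere of radius `√2` in a Euclidean space, normalized to total
mass `1`. -/
def sphereMeasure : Measure (Sphere2 E) :=
  (((volume : Measure E).toSphere Set.univ)⁻¹ • (volume : Measure E).toSphere).map dilate

end Sphere

/-- `ℍⁿ` with its Euclidean norm. -/
abbrev QuatSpace (n : ℕ) : Type := PiLp 2 fun _ : Fin n => ℍ[ℝ]

/-- `ℂⁿ` with its Euclidean norm. -/
abbrev ComplexSpace (n : ℕ) : Type := PiLp 2 fun _ : Fin n => ℂ

/-- The disjoint union of two copies of a measured space, each with half of its mass. -/
def twoCopies {X : Type} [MeasurableSpace X] (μ : Measure X) : Measure (X ⊕ X) :=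
  (2⁻¹ : ℝ≥0∞) • (μ.map Sum.inl + μ.map Sum.inr)

/-- The coordinatewise Hopf map `S⁴ⁿ⁻¹ → Arm₃(n)`. -/
def hopfArm3 {n : ℕ} (q : Sphere2 (QuatSpace n)) : Arm 3 n :=
  ⟨fun i => imVec (hopf (q.1 i)), by
    simp_rw [norm_imVec_hopf, ← PiLp.norm_sq_eq_of_L2, norm_eq_of_mem_sphere q]
    exact Real.sq_sqrt (by norm_num)⟩

/-- The coordinatewise Hopf map `S²ⁿ⁻¹ ⊔ S²ⁿ⁻¹ → Arm₂(n)`, where the two spheres lie in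
`(1 ⊕ 𝐣)ⁿ` (with complex coordinates `a + b 𝐣`) and `𝐢 (1 ⊕ 𝐣)ⁿ = (𝐢 ⊕ 𝐤)ⁿ`, and `ℝ²` is the
plane `𝐢 ⊕ 𝐤` of imaginary quaternions. -/
def hopfArm2 {n : ℕ} : Sphere2 (ComplexSpace n) ⊕ Sphere2 (ComplexSpace n) → Arm 2 n
  | .inl z => ⟨fun i => planeVec (hopf (pairQuat (z.1 i).re (z.1 i).im)), by
      have h (w : ℂ) : w.re ^ 2 + w.im ^ 2 = ‖w‖ ^ 2 := by
        rw [← Complex.normSq_eq_norm_sq, Complex.normSq_apply]; ring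
      simp_rw [norm_planeVec_hopf_real, h, ← PiLp.norm_sq_eq_of_L2, norm_eq_of_mem_sphere z]
      exact Real.sq_sqrt (by norm_num)⟩
  | .inr z => ⟨fun i => planeVec (hopf (qI * pairQuat (z.1 i).re (z.1 i).im)), by
      have h (w : ℂ) : w.re ^ 2 + w.im ^ 2 = ‖w‖ ^ 2 := by
        rw [← Complex.normSq_eq_norm_sq, Complex.normSq_apply]; ring
      simp_rw [norm_planeVec_hopf_imag, h, ← PiLp.norm_sq_eq_of_L2, norm_eq_of_mem_sphere z]
      exact Real.sq_sqrt (by norm_num)⟩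

/-- The symmetric measure on `Arm₃(n)`. -/
def symArm3 (n : ℕ) : Measure (Arm 3 n) := (sphereMeasure (QuatSpace n)).map hopfArm3

/-- The symmetric measure on `Arm₂(n)`. -/
def symArm2 (n : ℕ) : Measure (Arm 2 n) :=
  (twoCopies (sphereMeasure (ComplexSpace n))).map hopfArm2

/-! ### Stiefel manifolds and symmetric measures on closed polygon spaces -/

section Stiefel

variable (𝕜 : Type) [RCLike 𝕜] (n : ℕ)

/-- The Stiefel manifold `V₂(𝕜ⁿ)` of orthonormal `2`-frames in `𝕜ⁿ`, where `𝕜` is `ℝ` or `ℂ`. -/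
abbrev Stiefel : Type :=
  {p : EuclideanSpace 𝕜 (Fin n) × EuclideanSpace 𝕜 (Fin n) //
    ‖p.1‖ = 1 ∧ ‖p.2‖ = 1 ∧ inner 𝕜 p.1 p.2 = 0}

/-- The group `U(n)` for `𝕜 = ℂ`, and `O(n)` for `𝕜 = ℝ`. -/
abbrev U : Type := Matrix.unitaryGroup (Fin n) 𝕜

instance : MeasurableSpace (U 𝕜 n) := borel _

instance : BorelSpace (U 𝕜 n) := ⟨rfl⟩

instance : CompactSpace (U 𝕜 n) := by
  apply isCompact_iff_compactSpace.mp
  have hb : IsCompact (Set.univ.pi fun _ : Fin n => Set.univ.pi fun _ : Fin n =>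
      Metric.closedBall (0 : 𝕜) 1) :=
    isCompact_univ_pi fun _ => isCompact_univ_pi fun _ => isCompact_closedBall _ _
  refine hb.of_isClosed_subset (isClosed_unitary (R := Matrix (Fin n) (Fin n) 𝕜)) ?_
  intro A hA i _ j _
  simpa using entry_norm_bound_of_unitary hA i j

/-- The Haar measure of the compact group `U(n)` or `O(n)`, of total mass `1`. -/
def haarU : Measure (U 𝕜 n) := Measure.haarMeasure ⊤

variable {𝕜 n}

/-- The `j`-th column of a unitary matrix, i.e. the image of the `j`-th standard basis vector. -/
def column (g : U 𝕜 n) (j : Fin n) : EuclideanSpace 𝕜 (Fin n) :=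
  WithLp.toLp 2 fun i => g.1 i j

theorem inner_column (g : U 𝕜 n) (j k : Fin n) :
    inner 𝕜 (column g j) (column g k) = (1 : Matrix (Fin n) (Fin n) 𝕜) j k := by
  rw [← (Matrix.mem_unitaryGroup_iff'.mp g.2), Matrix.mul_apply]
  simp [column, PiLp.inner_apply, Matrix.star_apply, mul_comm]

/-- The orbit map `g ↦ (g e₁, g e₂)` from `U(n)` or `O(n)` onto the Stiefel manifold. -/
def orbitFrame (hn : 2 ≤ n) (g : U 𝕜 n) : Stiefel 𝕜 n :=
  ⟨(column g ⟨0, by omega⟩, column g ⟨1, by omega⟩), by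
    have h (j : Fin n) : ‖column g j‖ = 1 := by
      rw [← sq_eq_sq₀ (norm_nonneg _) zero_le_one, ← RCLike.ofReal_inj (K := 𝕜)]
      push_cast
      rw [← inner_self_eq_norm_sq_to_K, inner_column]
      simp
    exact ⟨h _, h _, by rw [inner_column]; simp⟩⟩

variable (𝕜) in
/-- The Haar measure on the Stiefel manifold, of total mass `1`: the probability measure induced
from the Haar measure of the group `U(n)` or `O(n)`, which acts transitively. -/
def stiefelMeasure (hn : 2 ≤ n) : Measure (Stiefel 𝕜 n) := (haarU 𝕜 n).map (orbitFrame hn)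

end Stiefel

/-- The coordinatewise Hopf map `V₂(ℂⁿ) → Pol₃(n)`, `(a, b) ↦ (Hopf (aᵢ + bᵢ 𝐣))ᵢ`. -/
def hopfPol3 {n : ℕ} (p : Stiefel ℂ n) : Pol 3 n :=
  ⟨fun i => imVec (hopf (pairQuat (p.1.1 i) (p.1.2 i))), by
    obtain ⟨⟨a, b⟩, ha, hb, hab⟩ := p
    have ha' : ∑ i, ‖a i‖ ^ 2 = 1 := by rw [← PiLp.norm_sq_eq_of_L2, ha, one_pow]
    have hb' : ∑ i, ‖b i‖ ^ 2 = 1 := by rw [← PiLp.norm_sq_eq_of_L2, hb, one_pow]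
    constructor
    · simp_rw [norm_imVec_hopf, norm_sq_pairQuat]
      rw [Finset.sum_add_distrib, ha', hb']
      norm_num
    · have h : ∑ i, a i * star (b i) = 0 := by
        rw [inner_eq_zero_symm] at hab
        simpa [PiLp.inner_apply] using hab
      have hre : ∑ i, (a i * star (b i)).re = 0 := by rw [← Complex.re_sum, h, Complex.zero_re]
      have him : ∑ i, (a i * star (b i)).im = 0 := by rw [← Complex.im_sum, h, Complex.zero_im]
      simp_rw [imVec_hopf_pairQuat]
      ext j
      rw [WithLp.ofLp_sum, Finset.sum_apply, PiLp.zero_apply]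
      fin_cases j
      · change ∑ i, (‖a i‖ ^ 2 - ‖b i‖ ^ 2) = 0
        rw [Finset.sum_sub_distrib, ha', hb', sub_self]
      · change ∑ i, 2 * (a i * star (b i)).im = 0
        rw [← Finset.mul_sum, him, mul_zero]
      · change ∑ i, 2 * (a i * star (b i)).re = 0
        rw [← Finset.mul_sum, hre, mul_zero]⟩

theorem sum_frame_norm {n : ℕ} (p : Stiefel ℝ n) :
    ∑ i, ((p.1.1 i) ^ 2 + (p.1.2 i) ^ 2) = 2 := by
  obtain ⟨⟨a, b⟩, ha, hb, hab⟩ := p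
  have ha' : ∑ i, ‖a i‖ ^ 2 = 1 := by rw [← PiLp.norm_sq_eq_of_L2, ha, one_pow]
  have hb' : ∑ i, ‖b i‖ ^ 2 = 1 := by rw [← PiLp.norm_sq_eq_of_L2, hb, one_pow]
  simp only [Real.norm_eq_abs, sq_abs] at ha' hb'
  rw [Finset.sum_add_distrib, ha', hb']
  norm_num

theorem sum_frame_sub {n : ℕ} (p : Stiefel ℝ n) :
    ∑ i, ((p.1.1 i) ^ 2 - (p.1.2 i) ^ 2) = 0 := by
  obtain ⟨⟨a, b⟩, ha, hb, hab⟩ := p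
  have ha' : ∑ i, ‖a i‖ ^ 2 = 1 := by rw [← PiLp.norm_sq_eq_of_L2, ha, one_pow]
  have hb' : ∑ i, ‖b i‖ ^ 2 = 1 := by rw [← PiLp.norm_sq_eq_of_L2, hb, one_pow]
  simp only [Real.norm_eq_abs, sq_abs] at ha' hb'
  rw [Finset.sum_sub_distrib, ha', hb', sub_self]

theorem sum_frame_mul {n : ℕ} (p : Stiefel ℝ n) : ∑ i, p.1.1 i * p.1.2 i = 0 := by
  obtain ⟨⟨a, b⟩, ha, hb, hab⟩ := p
  simpa [PiLp.inner_apply, mul_comm] using hab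

/-- The coordinatewise Hopf map `V₂(ℝⁿ) ⊔ 𝐢 V₂(ℝⁿ) → Pol₂(n)`, where `(a, b) ∈ V₂(ℝⁿ)` stands for
`a + b 𝐣`, and `ℝ²` is the plane `𝐢 ⊕ 𝐤` of imaginary quaternions. -/
def hopfPol2 {n : ℕ} : Stiefel ℝ n ⊕ Stiefel ℝ n → Pol 2 n
  | .inl p => ⟨fun i => planeVec (hopf (pairQuat (p.1.1 i) (p.1.2 i))), by
    constructor
    · simp_rw [norm_planeVec_hopf_real]
      exact sum_frame_norm p
    · simp_rw [hopf_real]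
      ext j
      rw [WithLp.ofLp_sum, Finset.sum_apply, PiLp.zero_apply]
      fin_cases j
      · exact sum_frame_sub p
      · change ∑ i, 2 * p.1.1 i * p.1.2 i = 0
        simp_rw [mul_assoc, ← Finset.mul_sum, sum_frame_mul, mul_zero]⟩
  | .inr p => ⟨fun i => planeVec (hopf (qI * pairQuat (p.1.1 i) (p.1.2 i))), by
    constructor
    · simp_rw [norm_planeVec_hopf_imag]
      exact sum_frame_norm p
    · simp_rw [hopf_imag]
      ext j
      rw [WithLp.ofLp_sum, Finset.sum_apply, PiLp.zero_apply]
      fin_cases j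
      · exact sum_frame_sub p
      · change ∑ i, 2 * p.1.1 i * p.1.2 i = 0
        simp_rw [mul_assoc, ← Finset.mul_sum, sum_frame_mul, mul_zero]⟩

/-- The symmetric measure on `Pol₃(n)`. -/
def symPol3 {n : ℕ} (hn : 2 ≤ n) : Measure (Pol 3 n) := (stiefelMeasure ℂ hn).map hopfPol3

/-- The symmetric measure on `Pol₂(n)`. -/
def symPol2 {n : ℕ} (hn : 2 ≤ n) : Measure (Pol 2 n) :=
  (twoCopies (stiefelMeasure ℝ hn)).map hopfPol2

end RandomPolygon

end

open RandomPolygon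

/-! Expanding the squared norm, the expected chord is `k A + k (k - 1) B` whenever all edges have
the same second moment `A` and any two distinct edges the same correlation `B` (`integral_chord`).
For arms `B = 0`: an isometry acting on a single coordinate (left multiplication by 𝐣 on ℍ, or by
the imaginary unit on ℂ) reverses one edge and fixes the others. For closed polygons, permutation
matrices make the correlation of edges `i` and `j ≠ i` independent of `j`, and closure forces `A +
(n - 1) B = 0`; this is the source of the factor `(n - k) / (n - 1)`.

Since `|Hopf q| = |q|²`, `A` is the fourth moment of the norm of a block of coordinates of a random
vector. For arms the block has 4 or 2 real coordinates on a sphere of radius `√2`. For closed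
polygons it consists of two entries of a row of a Haar random matrix, and such a row has a rotation
invariant law on the unit sphere of `𝕜ⁿ`. Invariance alone gives these moments
(`IsRotationInvariant.integral_sum_sq`): `E |x_i|⁴ = c E |x_i|² |x_j|²`, with `c = 3` over ℝ and `c
= 2` over ℂ, and the fixed norm of `x` sets the scale. -/

noncomputable section

namespace RandomPolygon

/-- A finite measure supported on the sphere of radius `r` and invariant under all linear
isometries of the space. -/
structure IsRotationInvariant (𝕜 : Type*) {E : Type*} [RCLike 𝕜] [NormedAddCommGroup E]
    [InnerProductSpace 𝕜 E] [MeasurableSpace E] (ν : Measure E) (r : ℝ) : Prop where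
  ae_norm : ∀ᵐ x ∂ν, ‖x‖ = r
  map_eq : ∀ L : E ≃ₗᵢ[𝕜] E, ν.map L = ν

/-! ### Orthonormal frames and isometries -/

section Frames

variable {𝕜 E : Type*} [RCLike 𝕜] [NormedAddCommGroup E] [InnerProductSpace 𝕜 E]
  {ι : Type*} [Fintype ι]

/-- Linear isometries act transitively on orthonormal frames. -/
theorem exists_isometry_apply_eq [FiniteDimensional 𝕜 E] (b : OrthonormalBasis ι 𝕜 E)
    (s : Set ι) {v : ι → E}
    (hv : Orthonormal 𝕜 (s.domRestrict v)) : ∃ L : E ≃ₗᵢ[𝕜] E, ∀ i ∈ s, L (b i) = v i := by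
  obtain ⟨b', hb'⟩ := hv.exists_orthonormalBasis_extension_of_card_eq
    (Module.finrank_eq_card_basis b.toBasis)
  refine ⟨b.equiv b' (Equiv.refl ι), fun i hi => ?_⟩
  rw [OrthonormalBasis.equiv_apply_basis]
  exact hb' i hi

theorem norm_add_sq_basis (b : OrthonormalBasis ι 𝕜 E) {i j : ι} (hij : i ≠ j) :
    ‖b i + b j‖ ^ 2 = 2 ∧ ‖b i - b j‖ ^ 2 = 2 := by
  have h : inner 𝕜 (b i) (b j) = 0 := b.orthonormal.2 hij
  constructor
  · rw [@norm_add_sq 𝕜, h, b.norm_eq_one, b.norm_eq_one, map_zero]; norm_num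
  · rw [@norm_sub_sq 𝕜, h, b.norm_eq_one, b.norm_eq_one, map_zero]; norm_num

end Frames

/-! ### Fourth moments of rotation invariant laws -/

section Moments

variable {𝕜 E : Type*} [RCLike 𝕜] [NormedAddCommGroup E] [InnerProductSpace 𝕜 E]
  [MeasurableSpace E] [BorelSpace E] {ν : Measure E} {r : ℝ}

theorem IsRotationInvariant.integral_comp (h : IsRotationInvariant 𝕜 ν r) (L : E ≃ₗᵢ[𝕜] E)
    {f : E → ℝ} (hf : Continuous f) :
    ∫ x, f (L x) ∂ν = ∫ x, f x ∂ν := by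
  conv_rhs => rw [← h.map_eq L]
  rw [integral_map L.continuous.aemeasurable hf.aestronglyMeasurable]

variable (𝕜) in
/-- The fourth moment of `ν` in a direction. -/
def fourthMoment (ν : Measure E) (u : E) : ℝ := ∫ x, ‖inner 𝕜 u x‖ ^ 4 ∂ν

variable (𝕜) in
/-- The mixed fourth moment of `ν` in two directions. -/
def mixedMoment (ν : Measure E) (u v : E) : ℝ :=
  ∫ x, ‖inner 𝕜 u x‖ ^ 2 * ‖inner 𝕜 v x‖ ^ 2 ∂ν

theorem IsRotationInvariant.fourthMoment_map (h : IsRotationInvariant 𝕜 ν r) (L : E ≃ₗᵢ[𝕜] E)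
    (u : E) : fourthMoment 𝕜 ν (L u) = fourthMoment 𝕜 ν u := by
  unfold fourthMoment
  rw [← h.integral_comp L (by fun_prop)]
  simp

variable [FiniteDimensional 𝕜 E] {ι : Type*} [Fintype ι]

/-- Isometries carry `b i` to any unit vector, and the moment is homogeneous of degree 4 in the
direction. -/
theorem IsRotationInvariant.fourthMoment_eq (h : IsRotationInvariant 𝕜 ν r)
    (b : OrthonormalBasis ι 𝕜 E) (i : ι) (w : E) :
    fourthMoment 𝕜 ν w = ‖w‖ ^ 4 * fourthMoment 𝕜 ν (b i) := by
  rcases eq_or_ne w 0 with rfl | hw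
  · simp [fourthMoment]
  have hw' : ‖w‖ ≠ 0 := norm_ne_zero_iff.mpr hw
  set u : E := ((‖w‖⁻¹ : ℝ) : 𝕜) • w with hu
  have hu1 : ‖u‖ = 1 := by
    rw [hu, norm_smul, RCLike.norm_ofReal, abs_of_nonneg (by positivity), inv_mul_cancel₀ hw']
  have hwu : w = ((‖w‖ : ℝ) : 𝕜) • u := by
    rw [hu, smul_smul, ← RCLike.ofReal_mul, mul_inv_cancel₀ hw', RCLike.ofReal_one, one_smul]
  obtain ⟨L, hL⟩ := exists_isometry_apply_eq b {i} (v := fun _ => u)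
    ⟨fun _ => hu1, fun a c hac => absurd (Subsingleton.elim a c) hac⟩
  have hmap := h.fourthMoment_map L (b i)
  rw [hL i rfl] at hmap
  rw [← hmap]
  conv_lhs => rw [hwu]
  unfold fourthMoment
  rw [← integral_const_mul]
  congr 1 with x
  rw [inner_smul_left, norm_mul]
  simp [mul_pow]

variable [IsFiniteMeasure ν]

theorem IsRotationInvariant.integrable (h : IsRotationInvariant 𝕜 ν r) {f : E → ℝ}
    (hf : Continuous f) : Integrable f ν := by
  have : ProperSpace E := FiniteDimensional.proper 𝕜 E
  obtain ⟨C, hC⟩ := (isCompact_closedBall (0 : E) r).exists_bound_of_continuousOn hf.continuousOn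
  refine Integrable.of_bound hf.aestronglyMeasurable C ?_
  filter_upwards [h.ae_norm] with x hx
  exact hC x (by simp [hx])

/-- With `s = |a|² + |b|²` and `t = Re (a b̄)`, one has `|a ± b|² = s ± 2t`, and the two squares add
up to `2s² + 8t²`. -/
theorem IsRotationInvariant.fourthMoment_add_sub (h : IsRotationInvariant 𝕜 ν r)
    (u v : E) : fourthMoment 𝕜 ν (u + v) + fourthMoment 𝕜 ν (u - v) =
      2 * fourthMoment 𝕜 ν u + 2 * fourthMoment 𝕜 ν v + 4 * mixedMoment 𝕜 ν u v +
        8 * ∫ x, (RCLike.re (inner 𝕜 u x * starRingEnd 𝕜 (inner 𝕜 v x))) ^ 2 ∂ν := by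
  unfold fourthMoment mixedMoment
  have key (a b : 𝕜) : ‖a + b‖ ^ 4 + ‖a - b‖ ^ 4 = 2 * ‖a‖ ^ 4 + 2 * ‖b‖ ^ 4 +
      4 * (‖a‖ ^ 2 * ‖b‖ ^ 2) + 8 * (RCLike.re (a * starRingEnd 𝕜 b)) ^ 2 := by
    have h4 (z : 𝕜) : ‖z‖ ^ 4 = (‖z‖ ^ 2) ^ 2 := by ring
    simp only [h4, ← RCLike.normSq_eq_def']
    rw [RCLike.normSq_add, RCLike.normSq_sub]
    ring
  rw [← integral_add (h.integrable (by fun_prop)) (h.integrable (by fun_prop))]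
  simp_rw [inner_add_left, inner_sub_left, key]
  have hre : Continuous fun x =>
      8 * (RCLike.re (inner 𝕜 u x * starRingEnd 𝕜 (inner 𝕜 v x))) ^ 2 :=
    continuous_const.mul ((RCLike.continuous_re.comp
      (.mul (by fun_prop) (RCLike.continuous_conj.comp (by fun_prop)))).pow 2)
  rw [integral_add (h.integrable (by fun_prop)) (h.integrable hre),
    integral_add (h.integrable (by fun_prop)) (h.integrable (by fun_prop)),
    integral_add (h.integrable (by fun_prop)) (h.integrable (by fun_prop)),
    integral_const_mul, integral_const_mul, integral_const_mul, integral_const_mul]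

/-- The fourth moment is `c` times the mixed moment, if the squared real part of `⟪u, x⟫ ⟪x, v⟫`
is `(c - 1) / 2` times its squared norm, in the mean. -/
theorem IsRotationInvariant.fourthMoment_eq_mul (h : IsRotationInvariant 𝕜 ν r)
    (b : OrthonormalBasis ι 𝕜 E) {i j : ι} (hij : i ≠ j) {c : ℝ}
    (hre : 2 * ∫ x, (RCLike.re (inner 𝕜 (b i) x * starRingEnd 𝕜 (inner 𝕜 (b j) x))) ^ 2 ∂ν =
      (c - 1) * mixedMoment 𝕜 ν (b i) (b j)) :
    fourthMoment 𝕜 ν (b i) = c * mixedMoment 𝕜 ν (b i) (b j) := by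
  have h1 := h.fourthMoment_add_sub (b i) (b j)
  have h4 (z : E) : ‖z‖ ^ 4 = (‖z‖ ^ 2) ^ 2 := by ring
  -- Both `b i ± b j` have norm `√2`, so the left side becomes 8 times the fourth moment of `b i`,
  -- against 4 times on the right.
  rw [h.fourthMoment_eq b i (b i + b j), h.fourthMoment_eq b i (b i - b j),
    h.fourthMoment_eq b i (b j), h4, h4, (norm_add_sq_basis b hij).1,
    (norm_add_sq_basis b hij).2, b.norm_eq_one] at h1
  linarith

/-- All mixed moments equal some `A` and all fourth moments `c A`, so a block `t` of basis vectors
contributes `|t| (|t| + c - 1) A`. The full basis, where the sum of squares is almost surely `r²`,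
determines `A`. -/
theorem IsRotationInvariant.integral_sum_sq [DecidableEq ι] [IsProbabilityMeasure ν]
    (h : IsRotationInvariant 𝕜 ν r)
    (b : OrthonormalBasis ι 𝕜 E) {c : ℝ} (hc : 0 < c)
    (hre : ∀ i j, i ≠ j →
      2 * ∫ x, (RCLike.re (inner 𝕜 (b i) x * starRingEnd 𝕜 (inner 𝕜 (b j) x))) ^ 2 ∂ν =
      (c - 1) * mixedMoment 𝕜 ν (b i) (b j)) (s : Finset ι) (hs : s.Nonempty) :
    ∫ x, (∑ i ∈ s, ‖inner 𝕜 (b i) x‖ ^ 2) ^ 2 ∂ν =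
      r ^ 4 * (s.card * (s.card + c - 1)) /
        (Fintype.card ι * (Fintype.card ι + c - 1)) := by
  obtain ⟨i₀, hi₀⟩ := hs
  -- `A` is defined through the fourth moment because a one-element basis has no mixed moments.
  obtain ⟨A, hA⟩ : ∃ A, fourthMoment 𝕜 ν (b i₀) = c * A :=
    ⟨fourthMoment 𝕜 ν (b i₀) / c, by field_simp⟩
  have hfour (i : ι) : fourthMoment 𝕜 ν (b i) = c * A := by
    rw [h.fourthMoment_eq b i₀ (b i), b.norm_eq_one, hA]; ring
  have hmix (i j : ι) (hij : i ≠ j) : mixedMoment 𝕜 ν (b i) (b j) = A := by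
    have := h.fourthMoment_eq_mul b hij (hre i j hij)
    rw [hfour] at this
    exact (mul_left_cancel₀ hc.ne' this).symm
  have hsum (t : Finset ι) : ∫ x, (∑ i ∈ t, ‖inner 𝕜 (b i) x‖ ^ 2) ^ 2 ∂ν =
      t.card * (t.card + c - 1) * A := by
    have hint (i j : ι) : Integrable (fun x => ‖inner 𝕜 (b i) x‖ ^ 2 * ‖inner 𝕜 (b j) x‖ ^ 2) ν :=
      h.integrable (by fun_prop)
    have hval (i j : ι) : ∫ x, ‖inner 𝕜 (b i) x‖ ^ 2 * ‖inner 𝕜 (b j) x‖ ^ 2 ∂ν =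
        A + if i = j then (c - 1) * A else 0 := by
      split_ifs with hij
      · subst hij
        have := hfour i
        unfold fourthMoment at this
        simp_rw [← pow_add]
        rw [this]; ring
      · rw [add_zero]; exact hmix i j hij
    simp_rw [sq (∑ i ∈ t, _), Finset.sum_mul_sum]
    rw [integral_finsetSum _ fun i _ => integrable_finsetSum _ fun j _ => hint i j]
    simp_rw [integral_finsetSum t fun j _ => hint _ j, hval, Finset.sum_add_distrib,
      Finset.sum_ite_eq]
    simp
    ring
  have htot : ∫ x, (∑ i, ‖inner 𝕜 (b i) x‖ ^ 2) ^ 2 ∂ν = r ^ 4 := by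
    have : ∀ᵐ x ∂ν, (∑ i, ‖inner 𝕜 (b i) x‖ ^ 2) ^ 2 = r ^ 4 := by
      filter_upwards [h.ae_norm] with x hx
      rw [b.sum_sq_norm_inner_right, hx]; ring
    rw [integral_congr_ae this]
    simp
  rw [hsum] at htot ⊢
  have hcard : 1 ≤ (Fintype.card ι : ℝ) := by
    exact_mod_cast Fintype.card_pos_iff.mpr ⟨i₀⟩
  have : (Fintype.card ι : ℝ) + c - 1 ≠ 0 := by linarith
  rw [← htot, Finset.card_univ]
  field_simp

end Moments

/-! ### The real constant -/

section Real

variable {E : Type*} [NormedAddCommGroup E] [InnerProductSpace ℝ E] [FiniteDimensional ℝ E]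
  [MeasurableSpace E] [BorelSpace E] {ι : Type*} [Fintype ι] [DecidableEq ι]
  {ν : Measure E} [IsProbabilityMeasure ν] {r : ℝ}

/-- Over ℝ the real part of `a b̄` is the whole product, so its squared mean is the mixed moment
itself and `2 = c - 1`. -/
theorem IsRotationInvariant.integral_sum_sq_real (h : IsRotationInvariant ℝ ν r)
    (b : OrthonormalBasis ι ℝ E) (s : Finset ι) (hs : s.Nonempty) :
    ∫ x, (∑ i ∈ s, (inner ℝ (b i) x) ^ 2) ^ 2 ∂ν =
      r ^ 4 * (s.card * (s.card + 2)) / (Fintype.card ι * (Fintype.card ι + 2)) := by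
  have := h.integral_sum_sq b (c := 3) (by norm_num) (fun i j _ => by
    simp [mixedMoment, mul_pow]; norm_num) s hs
  simp only [Real.norm_eq_abs, sq_abs] at this
  rw [this]
  ring_nf

end Real

/-! ### The complex constant -/

section Complex

variable {E : Type*} [NormedAddCommGroup E] [InnerProductSpace ℂ E] [FiniteDimensional ℂ E]
  [MeasurableSpace E] [BorelSpace E] {ι : Type*} [Fintype ι] [DecidableEq ι]
  {ν : Measure E} [IsProbabilityMeasure ν] {r : ℝ}

/-- The squares of the real and imaginary parts of `a b̄` have equal means, each half the mixed
moment, so `1 = c - 1`. -/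
theorem IsRotationInvariant.integral_sum_sq_complex (h : IsRotationInvariant ℂ ν r)
    (b : OrthonormalBasis ι ℂ E) (s : Finset ι) (hs : s.Nonempty) :
    ∫ x, (∑ i ∈ s, ‖inner ℂ (b i) x‖ ^ 2) ^ 2 ∂ν =
      r ^ 4 * (s.card * (s.card + 1)) / (Fintype.card ι * (Fintype.card ι + 1)) := by
  have := h.integral_sum_sq b (c := 2) (by norm_num) (fun i j hij => by
    -- `L` rotates `b i` by the phase `I` and fixes `b j`; it turns the real part of the product
    -- into the imaginary part.
    obtain ⟨L, hL⟩ := exists_isometry_apply_eq b {i, j}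
      (v := fun k => if k = i then Complex.I • b i else b k) (by
        constructor
        · rintro ⟨k, hk⟩
          rw [Set.domRestrict_apply]
          split_ifs <;> simp [norm_smul]
        · rintro ⟨k, hk⟩ ⟨l, hl⟩ hkl
          have hkl' : k ≠ l := fun e => hkl (Subtype.ext e)
          rw [Set.domRestrict_apply, Set.domRestrict_apply]
          split_ifs with h1 h2 h2
          · exact absurd (h1.trans h2.symm) hkl'
          · have := b.orthonormal.2 hkl'
            rw [show k = i from h1] at this
            rw [inner_smul_left, this, mul_zero]
          · have := b.orthonormal.2 hkl'
            rw [show l = i from h2] at this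
            rw [inner_smul_right, this, mul_zero]
          · exact b.orthonormal.2 hkl')
    have hi : L (b i) = Complex.I • b i := by simp [hL i]
    have hj : L (b j) = b j := by simp [hL j, hij.symm]
    have key : ∫ x, ((inner ℂ (b i) x * starRingEnd ℂ (inner ℂ (b j) x)).re) ^ 2 ∂ν =
        ∫ x, ((inner ℂ (b i) x * starRingEnd ℂ (inner ℂ (b j) x)).im) ^ 2 ∂ν := by
      have h1 : ∫ x, ((inner ℂ (L (b i)) x * starRingEnd ℂ (inner ℂ (L (b j)) x)).re) ^ 2 ∂ν =
          ∫ x, ((inner ℂ (b i) x * starRingEnd ℂ (inner ℂ (b j) x)).re) ^ 2 ∂ν := by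
        rw [← h.integral_comp L (by fun_prop)]
        simp only [LinearIsometryEquiv.inner_map_map]
      rw [← h1, hi, hj]
      congr 1 with x
      rw [inner_smul_left, mul_assoc]
      simp
    have hsum : mixedMoment ℂ ν (b i) (b j) =
        ∫ x, ((inner ℂ (b i) x * starRingEnd ℂ (inner ℂ (b j) x)).re) ^ 2 ∂ν +
        ∫ x, ((inner ℂ (b i) x * starRingEnd ℂ (inner ℂ (b j) x)).im) ^ 2 ∂ν := by
      rw [← integral_add (h.integrable (by fun_prop)) (h.integrable (by fun_prop))]
      unfold mixedMoment
      congr 1 with x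
      rw [← mul_pow, ← RCLike.norm_conj (inner ℂ (b j) x), ← norm_mul,
        ← Complex.normSq_eq_norm_sq, Complex.normSq_apply]
      ring
    change 2 * ∫ x, ((inner ℂ (b i) x * starRingEnd ℂ (inner ℂ (b j) x)).re) ^ 2 ∂ν = _
    rw [hsum, ← key]; ring) s hs
  rw [this]
  ring_nf

end Complex

/-! ### Rotation invariance of the surface measure -/

section SphereLaw

open scoped Pointwise

variable {E : Type} [NormedAddCommGroup E] [InnerProductSpace ℝ E]

/-- The action of a linear isometry on the unit sphere. -/
def sphereMap (L : E ≃ₗᵢ[ℝ] E) (x : Metric.sphere (0 : E) 1) : Metric.sphere (0 : E) 1 :=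
  ⟨L x, by simp⟩

theorem continuous_sphereMap (L : E ≃ₗᵢ[ℝ] E) : Continuous (sphereMap L) :=
  (L.continuous.comp continuous_subtype_val).subtype_mk _

theorem continuous_dilate : Continuous (dilate : Metric.sphere (0 : E) 1 → Sphere2 E) :=
  (continuous_subtype_val.const_smul (√2)).subtype_mk _

/-- `Measure.toSphere` measures a set through the volume of the cone over it, so invariance on the
sphere reduces to cones being compatible with `L`. -/
theorem smul_image_preimage_sphereMap (L : E ≃ₗᵢ[ℝ] E) (s : Set (Metric.sphere (0 : E) 1)) :
    Set.Ioo (0 : ℝ) 1 • (((↑) : Metric.sphere (0 : E) 1 → E) '' (sphereMap L ⁻¹' s)) =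
      L ⁻¹' (Set.Ioo (0 : ℝ) 1 • (((↑) : Metric.sphere (0 : E) 1 → E) '' s)) := by
  ext y
  simp only [Set.mem_smul, Set.mem_image, Set.mem_preimage]
  constructor
  · rintro ⟨t, ht, _, ⟨x, hx, rfl⟩, rfl⟩
    exact ⟨t, ht, _, ⟨_, hx, rfl⟩, by simp [sphereMap]⟩
  · rintro ⟨t, ht, _, ⟨x, hx, rfl⟩, hxy⟩
    refine ⟨t, ht, _, ⟨⟨L.symm x, by simp⟩, ?_, rfl⟩, ?_⟩
    · convert hx
      simp [sphereMap]
    · apply L.injective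
      simp [← hxy]

variable [FiniteDimensional ℝ E] [MeasurableSpace E] [BorelSpace E]

theorem map_sphereMap_toSphere (L : E ≃ₗᵢ[ℝ] E) :
    ((volume : Measure E).toSphere).map (sphereMap L) = (volume : Measure E).toSphere := by
  ext s hs
  have hL : Measurable (sphereMap L) := (continuous_sphereMap L).measurable
  rw [Measure.map_apply hL hs, Measure.toSphere_apply' _ (hL hs), Measure.toSphere_apply' _ hs,
    smul_image_preimage_sphereMap]
  congr 1
  exact L.measurePreserving.measure_preimage_equiv (f := L.toHomeomorph.toMeasurableEquiv) _

/-- In the zero space the sphere is empty and the normalization would fail. -/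
instance [Nontrivial E] : IsProbabilityMeasure (sphereMeasure E) := by
  have : NeZero ((volume : Measure E).toSphere) := ⟨Measure.toSphere_ne_zero _⟩
  have : IsProbabilityMeasure
      (((volume : Measure E).toSphere Set.univ)⁻¹ • (volume : Measure E).toSphere) :=
    isProbabilityMeasureSMul
  exact Measure.isProbabilityMeasure_map continuous_dilate.aemeasurable

theorem isRotationInvariant_sphereMeasure :
    IsRotationInvariant ℝ ((sphereMeasure E).map ((↑) : Sphere2 E → E)) (√2) where
  ae_norm := by
    rw [ae_map_iff measurable_subtype_coe.aemeasurable
      (measurableSet_eq_fun measurable_norm measurable_const)]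
    exact .of_forall fun x => norm_eq_of_mem_sphere x
  map_eq L := by
    have hL : Measurable (sphereMap L) := (continuous_sphereMap L).measurable
    have hd : Measurable (dilate : _ → Sphere2 E) := continuous_dilate.measurable
    unfold sphereMeasure
    conv_rhs => rw [← map_sphereMap_toSphere L, ← Measure.map_smul, Measure.map_map hd hL,
      Measure.map_map measurable_subtype_coe (hd.comp hL)]
    rw [Measure.map_map measurable_subtype_coe hd,
      Measure.map_map L.continuous.measurable (measurable_subtype_coe.comp hd),
      Measure.map_apply hL .univ, Set.preimage_univ]
    congr 1
    ext x
    simp [dilate, sphereMap]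

end SphereLaw

/-! ### Rows of a Haar random unitary matrix -/

section HaarLaw

variable {𝕜 : Type} [RCLike 𝕜] {n : ℕ}

instance : IsProbabilityMeasure (haarU 𝕜 n) := ⟨by
  simpa [haarU] using
    Measure.haarMeasure_self (K₀ := (⊤ : TopologicalSpace.PositiveCompacts (U 𝕜 n)))⟩

instance : (haarU 𝕜 n).IsHaarMeasure := by unfold haarU; infer_instance

/-- A right translate of the Haar measure is again a left Haar probability measure, and that measure
is unique. -/
instance : (haarU 𝕜 n).IsMulRightInvariant where
  map_mul_right_eq_self g := by
    have h1 : IsProbabilityMeasure ((haarU 𝕜 n).map (· * g)) :=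
      Measure.isProbabilityMeasure_map (continuous_mul_const g).aemeasurable
    exact Measure.isHaarMeasure_eq_of_isProbabilityMeasure _ _

/-- The `i`-th row of a unitary matrix. -/
def row (i : Fin n) (g : U 𝕜 n) : EuclideanSpace 𝕜 (Fin n) :=
  WithLp.toLp 2 fun j => g.1 i j

theorem continuous_entry (i j : Fin n) : Continuous fun g : U 𝕜 n => g.1 i j :=
  (continuous_apply_apply i j).comp continuous_subtype_val

theorem continuous_row (i : Fin n) : Continuous (row i : U 𝕜 n → _) :=
  (PiLp.continuous_toLp 2 _).comp (continuous_pi fun j => continuous_entry i j)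

theorem norm_row (i : Fin n) (g : U 𝕜 n) : ‖row i g‖ = 1 := by
  have h := congrFun (congrFun (Matrix.mem_unitaryGroup_iff.mp g.2) i) i
  rw [← sq_eq_sq₀ (norm_nonneg _) zero_le_one, PiLp.norm_sq_eq_of_L2, one_pow,
    ← RCLike.ofReal_inj (K := 𝕜)]
  rw [Matrix.mul_apply, Matrix.one_apply_eq] at h
  push_cast
  rw [← h]
  refine Finset.sum_congr rfl fun j _ => ?_
  rw [Matrix.star_apply, RCLike.star_def, RCLike.mul_conj]
  rfl

/-- The unitary matrix whose right multiplication acts on rows as a given linear isometry. -/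
def matrixOfIsometry
    (L : EuclideanSpace 𝕜 (Fin n) ≃ₗᵢ[𝕜] EuclideanSpace 𝕜 (Fin n)) : U 𝕜 n :=
  ⟨Matrix.of fun j k => L (EuclideanSpace.single j 1) k, by
    rw [Matrix.mem_unitaryGroup_iff]
    ext j l
    have h := L.inner_map_map (EuclideanSpace.single l (1 : 𝕜)) (EuclideanSpace.single j 1)
    rw [PiLp.inner_apply] at h
    rw [Matrix.mul_apply]
    simpa [Matrix.star_apply, Matrix.one_apply, RCLike.inner_apply, eq_comm,
      EuclideanSpace.inner_single_left, Pi.single_apply] using h⟩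

theorem row_mul_matrixOfIsometry (i : Fin n) (g : U 𝕜 n)
    (L : EuclideanSpace 𝕜 (Fin n) ≃ₗᵢ[𝕜] EuclideanSpace 𝕜 (Fin n)) :
    row i (g * matrixOfIsometry L) = L (row i g) := by
  have h : row i g = ∑ j, g.1 i j • EuclideanSpace.single j (1 : 𝕜) := by
    ext k
    simp [row, Pi.single_apply]
  rw [h, map_sum]
  ext k
  simp [row, matrixOfIsometry, Matrix.mul_apply]

/-- Frames are columns, but edge `i` depends only on row `i`. Right multiplication acts on rows, by
an arbitrary isometry, and preserves Haar measure. -/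
theorem isRotationInvariant_row (i : Fin n) :
    IsRotationInvariant 𝕜 ((haarU 𝕜 n).map (row i)) 1 where
  ae_norm := by
    rw [ae_map_iff (continuous_row i).aemeasurable
      (measurableSet_eq_fun measurable_norm measurable_const)]
    exact .of_forall fun g => norm_row i g
  map_eq L := by
    conv_rhs => rw [← map_mul_right_eq_self (haarU 𝕜 n) (matrixOfIsometry L)]
    rw [Measure.map_map (continuous_row i).measurable (continuous_mul_const _).measurable,
      Measure.map_map L.continuous.measurable (continuous_row i).measurable]
    congr 1
    ext1 g
    exact (row_mul_matrixOfIsometry i g L).symm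

end HaarLaw

/-! ### Chords and edge correlations -/

section Chord

variable {Ω : Type*} [MeasurableSpace Ω] {μ : Measure Ω} {d n : ℕ}

theorem chord_eq_sum_inner (k : ℕ) (e : Fin n → EuclideanSpace ℝ (Fin d)) :
    chord k e = ∑ i with i.val < k, ∑ j with j.val < k, inner ℝ (e i) (e j) := by
  rw [chord, ← real_inner_self_eq_norm_sq, sum_inner]
  simp_rw [inner_sum]

theorem continuous_chord (k : ℕ) :
    Continuous fun e : Fin n → EuclideanSpace ℝ (Fin d) => chord k e := by
  unfold chord
  fun_prop

/-- The expected chord length of a random polygon whose edges have second moments `A` and pairwise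
correlations `B`. -/
theorem integral_chord {e : Ω → Fin n → EuclideanSpace ℝ (Fin d)} {A B : ℝ}
    (hint : ∀ i j, Integrable (fun ω => inner ℝ (e ω i) (e ω j)) μ)
    (hA : ∀ i, ∫ ω, ‖e ω i‖ ^ 2 ∂μ = A)
    (hB : ∀ i j, i ≠ j → ∫ ω, inner ℝ (e ω i) (e ω j) ∂μ = B) {k : ℕ} (hk : k ≤ n) :
    ∫ ω, chord k (e ω) ∂μ = k * A + k * (k - 1) * B := by
  have hval (i j : Fin n) : ∫ ω, inner ℝ (e ω i) (e ω j) ∂μ = B + if i = j then A - B else 0 := by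
    split_ifs with hij
    · subst hij
      simp_rw [real_inner_self_eq_norm_sq, hA]
      ring
    · rw [add_zero, hB i j hij]
  have hcard : (Finset.univ.filter fun i : Fin n => i.val < k).card = k := by
    rw [Fin.card_filter_val_lt, min_eq_right hk]
  simp_rw [chord_eq_sum_inner]
  rw [integral_finsetSum _ fun i _ => integrable_finsetSum _ fun j _ => hint i j]
  simp_rw [integral_finsetSum _ fun j _ => hint _ j, hval, Finset.sum_add_distrib,
    Finset.sum_ite_eq]
  rw [Finset.sum_ite_of_true (fun i hi => hi)]
  simp only [Finset.sum_const, hcard, nsmul_eq_mul]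
  ring

end Chord

/-! ### Expected chords of arms -/

section Arm

variable {F : Type} [NormedAddCommGroup F] [InnerProductSpace ℝ F] [FiniteDimensional ℝ F]
  {n d : ℕ} [MeasurableSpace (PiLp 2 fun _ : Fin n => F)] [BorelSpace (PiLp 2 fun _ : Fin n => F)]

/-- This is `integral_sum_sq_real` for the block of basis vectors lying in the `i`-th copy of `F`:
`dim F` of them out of `n dim F`. -/
theorem IsRotationInvariant.integral_norm_coord
    {ν : Measure (PiLp 2 fun _ : Fin n => F)} [IsProbabilityMeasure ν] {r : ℝ} [Nontrivial F]
    (h : IsRotationInvariant ℝ ν r) (i : Fin n) :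
    ∫ x, ‖x i‖ ^ 4 ∂ν =
      r ^ 4 * (Module.finrank ℝ F * (Module.finrank ℝ F + 2)) /
        (n * Module.finrank ℝ F * (n * Module.finrank ℝ F + 2)) := by
  set c := stdOrthonormalBasis ℝ F
  set b := Pi.orthonormalBasis fun _ : Fin n => c with hb
  have hpos : 0 < Module.finrank ℝ F := Module.finrank_pos
  have h1 := h.integral_sum_sq_real b (Finset.univ.map (Function.Embedding.sigmaMk i))
    (by rw [Finset.map_nonempty]; exact ⟨⟨0, hpos⟩, Finset.mem_univ _⟩)
  rw [Finset.card_map, Finset.card_univ, Fintype.card_fin, Fintype.card_sigma] at h1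
  simp only [Fintype.card_fin, Finset.sum_const, Finset.card_univ, smul_eq_mul,
    Nat.cast_mul] at h1
  rw [← h1]
  congr 1 with x
  rw [Finset.sum_map]
  have h2 (j : Fin (Module.finrank ℝ F)) :
      inner ℝ (b (Function.Embedding.sigmaMk i j)) x = inner ℝ (c j) (x i) := by
    rw [← b.repr_apply_apply, ← c.repr_apply_apply]
    rfl
  simp_rw [h2, c.sum_sq_inner_right]
  ring

/-- The expected chord length of a random arm with edges `f (x i)`, for a random point `x` with
rotation invariant law, provided `‖f q‖ = ‖q‖²` and `-f` is `f` after an isometry. -/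
theorem IsRotationInvariant.integral_chord_comp
    {ν : Measure (PiLp 2 fun _ : Fin n => F)} [IsProbabilityMeasure ν] {r : ℝ} [Nontrivial F]
    (h : IsRotationInvariant ℝ ν r) {f : F → EuclideanSpace ℝ (Fin d)} (hf : Continuous f)
    (hnorm : ∀ q, ‖f q‖ = ‖q‖ ^ 2) (J : F ≃ₗᵢ[ℝ] F) (hJ : ∀ q, f (J q) = -f q)
    {k : ℕ} (hk : k ≤ n) :
    ∫ x, chord k (fun i => f (x i)) ∂ν =
      k * (r ^ 4 * (Module.finrank ℝ F * (Module.finrank ℝ F + 2)) /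
        (n * Module.finrank ℝ F * (n * Module.finrank ℝ F + 2))) := by
  rw [integral_chord (e := fun x i => f (x i)) (B := 0)
    (A := r ^ 4 * (Module.finrank ℝ F * (Module.finrank ℝ F + 2)) /
      (n * Module.finrank ℝ F * (n * Module.finrank ℝ F + 2)))
    (fun i j => h.integrable (by fun_prop)) (fun i => ?_) (fun i j hij => ?_) hk]
  · rw [mul_zero, add_zero]
  · rw [← h.integral_norm_coord i]
    congr 1 with x
    rw [hnorm, ← pow_mul]
  -- Applying `J` to coordinate `i` alone changes the sign of the correlation, which therefore
  -- vanishes.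
  · have h1 := h.integral_comp
      (LinearIsometryEquiv.piLpCongrRight 2 fun l => if l = i then J else .refl ℝ F)
      (f := fun x => inner ℝ (f (x i)) (f (x j))) (by fun_prop)
    simp only [LinearIsometryEquiv.piLpCongrRight_apply, if_true, if_neg hij.symm, hJ,
      inner_neg_left, integral_neg, LinearIsometryEquiv.coe_refl, id] at h1
    linarith

end Arm

/-! ### Expected chords of closed polygons -/

section Pol

variable {𝕜 : Type} [RCLike 𝕜] {n d : ℕ}

theorem integrable_haarU {f : U 𝕜 n → ℝ} (hf : Continuous f) : Integrable f (haarU 𝕜 n) :=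
  hf.integrable_of_hasCompactSupport (HasCompactSupport.of_compactSpace f)

/-- The unitary matrix of a permutation of the coordinates. -/
def permU (𝕜 : Type) [RCLike 𝕜] (σ : Equiv.Perm (Fin n)) : U 𝕜 n :=
  ⟨σ.permMatrix 𝕜, by
    rw [Matrix.mem_unitaryGroup_iff, Matrix.star_eq_conjTranspose, Matrix.conjTranspose_permMatrix,
      ← Matrix.permMatrix_mul]
    simp⟩

theorem permU_mul_apply (σ : Equiv.Perm (Fin n)) (g : U 𝕜 n) (i j : Fin n) :
    (permU 𝕜 σ * g).1 i j = g.1 (σ i) j := by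
  change (σ.permMatrix 𝕜 * g.1) i j = _
  rw [Equiv.Perm.permMatrix, PEquiv.toMatrix_toPEquiv_mul]
  rfl

/-- The expected chord length of a random closed polygon with edges `f (g i 0) (g i 1)`, for a
random unitary matrix `g`. -/
theorem integral_chord_haarU (hn : 2 ≤ n) {f : 𝕜 → 𝕜 → EuclideanSpace ℝ (Fin d)}
    (hf : Continuous fun p : 𝕜 × 𝕜 => f p.1 p.2)
    (hnorm : ∀ a b, ‖f a b‖ = ‖a‖ ^ 2 + ‖b‖ ^ 2)
    (hclosed : ∀ g : U 𝕜 n, ∑ i, f (g.1 i ⟨0, by omega⟩) (g.1 i ⟨1, by omega⟩) = 0)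
    {M : ℝ} (hM : ∀ i, ∫ x, (‖x ⟨0, by omega⟩‖ ^ 2 + ‖x ⟨1, by omega⟩‖ ^ 2) ^ 2
      ∂((haarU 𝕜 n).map (row i)) = M)
    {k : ℕ} (hk : k ≤ n) :
    ∫ g, chord k (fun i => f (g.1 i ⟨0, by omega⟩) (g.1 i ⟨1, by omega⟩)) ∂(haarU 𝕜 n) =
      ((n : ℝ) - k) / ((n : ℝ) - 1) * (k * M) := by
  set e : U 𝕜 n → Fin n → EuclideanSpace ℝ (Fin d) :=
    fun g i => f (g.1 i ⟨0, by omega⟩) (g.1 i ⟨1, by omega⟩) with he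
  have hcont (i : Fin n) : Continuous fun g => e g i :=
    hf.comp ((continuous_entry i _).prodMk (continuous_entry i _))
  have hint (i j : Fin n) : Integrable (fun g => inner ℝ (e g i) (e g j)) (haarU 𝕜 n) :=
    integrable_haarU ((hcont i).inner (hcont j))
  have hA (i : Fin n) : ∫ g, ‖e g i‖ ^ 2 ∂(haarU 𝕜 n) = M := by
    rw [← hM i, integral_map (continuous_row i).aemeasurable
      (Continuous.aestronglyMeasurable (by fun_prop))]
    simp_rw [he, hnorm]
    rfl
  have hsymm (i j l : Fin n) (hj : j ≠ i) (hl : l ≠ i) :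
      ∫ g, inner ℝ (e g i) (e g l) ∂(haarU 𝕜 n) = ∫ g, inner ℝ (e g i) (e g j) ∂(haarU 𝕜 n) := by
    -- Swapping rows `j` and `l` is a left translation, and it leaves row `i` alone.
    rw [← integral_mul_left_eq_self _ (permU 𝕜 (Equiv.swap j l))]
    simp only [he, permU_mul_apply, Equiv.swap_apply_right,
      Equiv.swap_apply_of_ne_of_ne hj.symm hl.symm]
  have hn1 : (n : ℝ) - 1 ≠ 0 := by
    have : (2 : ℝ) ≤ n := by exact_mod_cast hn
    linarith
  have hB (i j : Fin n) (hij : i ≠ j) :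
      ∫ g, inner ℝ (e g i) (e g j) ∂(haarU 𝕜 n) = -M / (n - 1) := by
    -- Pairing edge `i` with the closure relation gives `M + (n - 1) B = 0`.
    have h0 : ∑ l, ∫ g, inner ℝ (e g i) (e g l) ∂(haarU 𝕜 n) = 0 := by
      rw [← integral_finsetSum _ fun l _ => hint i l]
      simp_rw [← inner_sum, he, hclosed, inner_zero_right, integral_zero]
    rw [← Finset.add_sum_erase _ _ (Finset.mem_univ i),
      Finset.sum_congr rfl fun l hl => hsymm i j l hij.symm (Finset.ne_of_mem_erase hl)] at h0
    simp_rw [real_inner_self_eq_norm_sq, hA] at h0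
    rw [Finset.sum_const, Finset.card_erase_of_mem (Finset.mem_univ i), Finset.card_univ,
      Fintype.card_fin, nsmul_eq_mul, Nat.cast_sub (by omega), Nat.cast_one] at h0
    rw [eq_div_iff hn1]
    linarith
  rw [integral_chord hint hA hB hk]
  field_simp
  ring

end Pol

/-! ### Pushforwards, boundedness of chords, and symmetries of the Hopf map -/

/-- Used in the planar cases: since `(𝐢q)‾ 𝐢 (𝐢q) = q̄ 𝐢 q`, both components have the same image
under the Hopf map, and the two halves of the mass recombine. -/
theorem map_twoCopies {X Y : Type} [MeasurableSpace X] [MeasurableSpace Y] {μ : Measure X}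
    {F : X ⊕ X → Y} {G : X → Y} (hG : Measurable G) (hl : ∀ x, F (.inl x) = G x)
    (hr : ∀ x, F (.inr x) = G x) : (twoCopies μ).map F = μ.map G := by
  have hF : Measurable F := measurable_fun_sum (by simpa [Function.comp_def, hl] using hG)
    (by simpa [Function.comp_def, hr] using hG)
  rw [twoCopies, Measure.map_smul, Measure.map_add _ _ hF, Measure.map_map hF measurable_inl,
    Measure.map_map hF measurable_inr, show F ∘ Sum.inl = G from funext hl,
    show F ∘ Sum.inr = G from funext hr, ← two_smul ℝ≥0∞, smul_smul,
    ENNReal.inv_mul_cancel two_ne_zero ENNReal.ofNat_ne_top, one_smul]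

theorem chord_le {d n : ℕ} (k : ℕ) {e : Fin n → EuclideanSpace ℝ (Fin d)}
    (he : ∑ i, ‖e i‖ = 2) : chord k e ≤ 4 := by
  have h : ‖∑ i with i.val < k, e i‖ ≤ 2 := by
    rw [← he]
    exact (norm_sum_le _ _).trans (Finset.sum_le_sum_of_subset_of_nonneg (Finset.filter_subset _ _)
      fun _ _ _ => norm_nonneg _)
  unfold chord
  nlinarith [norm_nonneg (∑ i with i.val < k, e i)]

/-- A continuous function bounded by `chord_le` is integrable for a finite measure; the predicate
`p` covers arms and closed polygons alike. -/
theorem integrable_chord {d n : ℕ} (k : ℕ) {p : (Fin n → EuclideanSpace ℝ (Fin d)) → Prop}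
    (hp : ∀ e, p e → ∑ i, ‖e i‖ = 2) (μ : Measure {e // p e}) [IsFiniteMeasure μ] :
    Integrable (fun P => chord k P.1) μ := by
  refine Integrable.of_bound
    ((continuous_chord k).comp continuous_subtype_val).aestronglyMeasurable 4
    (.of_forall fun P => ?_)
  rw [Real.norm_of_nonneg (by unfold chord; positivity)]
  exact chord_le k (hp _ P.2)

theorem integral_chord_map {Ω : Type*} [MeasurableSpace Ω] {μ : Measure Ω} {d n : ℕ} (k : ℕ)
    {p : (Fin n → EuclideanSpace ℝ (Fin d)) → Prop} {F : Ω → {e // p e}} (hF : Measurable F) :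
    ∫ P, chord k P.1 ∂(μ.map F) = ∫ ω, chord k (F ω).1 ∂μ :=
  integral_map hF.aemeasurable
    ((continuous_chord k).comp continuous_subtype_val).aestronglyMeasurable

theorem continuous_imVec_hopf : Continuous fun q => imVec (hopf q) := by
  have h0 := Quaternion.continuous_re
  have h1 := Quaternion.continuous_imI
  have h2 := Quaternion.continuous_imJ
  have h3 := Quaternion.continuous_imK
  simp only [hopf_eq, imVec]
  refine (PiLp.continuous_toLp 2 _).comp (continuous_pi fun i => ?_)
  fin_cases i <;> simp <;> fun_prop

/-- The edge `(a² - b², 2ab)` of a planar polygon, i.e. the square of `a + b i`. -/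
def planeEdge (a b : ℝ) : EuclideanSpace ℝ (Fin 2) := planeVec (hopf (pairQuat a b))

theorem planeEdge_eq (a b : ℝ) : planeEdge a b = !₂[a ^ 2 - b ^ 2, 2 * a * b] := by
  simp [planeEdge, hopf_real, planeVec]

theorem planeEdge_eq_imag (a b : ℝ) : planeVec (hopf (qI * pairQuat a b)) = planeEdge a b := by
  rw [planeEdge, hopf_real, hopf_imag]

theorem continuous_planeEdge_comp {X : Type*} [TopologicalSpace X] {f g : X → ℝ}
    (hf : Continuous f) (hg : Continuous g) : Continuous fun x => planeEdge (f x) (g x) := by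
  simp only [planeEdge_eq]
  refine (PiLp.continuous_toLp 2 _).comp (continuous_pi fun i => ?_)
  fin_cases i <;> simp <;> fun_prop

/-- Left multiplication by `𝐣`. -/
def leftMulJ : ℍ[ℝ] ≃ₗᵢ[ℝ] ℍ[ℝ] :=
  LinearIsometry.toLinearIsometryEquiv
    ⟨LinearMap.mulLeft ℝ qJ, fun q => by
      have h : ‖qJ‖ = 1 := by
        rw [← sq_eq_sq₀ (norm_nonneg _) zero_le_one, norm_sq_eq]
        simp [qJ]
      simp [h]⟩ rfl

/-- Because `𝐣̄ 𝐢 𝐣 = -𝐢`. -/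
theorem imVec_hopf_leftMulJ (q : ℍ[ℝ]) : imVec (hopf (leftMulJ q)) = -imVec (hopf q) := by
  change imVec (hopf (qJ * q)) = _
  rw [hopf_eq, hopf_eq]
  ext i
  fin_cases i <;> simp [imVec] <;> simp [qJ] <;> ring

/-- Multiplication by `i`. -/
def mulI : ℂ ≃ₗᵢ[ℝ] ℂ :=
  LinearIsometry.toLinearIsometryEquiv ⟨LinearMap.mulLeft ℝ Complex.I, fun q => by simp⟩ rfl

/-- The edge is the complex square of `z`, and `(iz)² = -z²`. -/
theorem planeEdge_mulI (z : ℂ) :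
    planeEdge (mulI z).re (mulI z).im = -planeEdge z.re z.im := by
  change planeEdge (Complex.I * z).re (Complex.I * z).im = _
  rw [planeEdge_eq, planeEdge_eq]
  ext i
  fin_cases i <;> simp
  ring

theorem norm_planeEdge (a b : ℝ) : ‖planeEdge a b‖ = a ^ 2 + b ^ 2 := norm_planeVec_hopf_real a b

/-! ### The four symmetric measures -/

theorem measurable_hopfArm3 {n : ℕ} : Measurable (hopfArm3 (n := n)) := by
  refine Continuous.measurable (Continuous.subtype_mk (continuous_pi fun i => ?_) _)
  exact continuous_imVec_hopf.comp ((PiLp.continuous_apply 2 _ i).comp continuous_subtype_val)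

theorem hopfArm2_inl_apply {n : ℕ} (z : Sphere2 (ComplexSpace n)) (i : Fin n) :
    (hopfArm2 (.inl z)).1 i = planeEdge (z.1 i).re (z.1 i).im := by
  rw [hopfArm2, planeEdge]

theorem hopfArm2_inr {n : ℕ} (z : Sphere2 (ComplexSpace n)) :
    hopfArm2 (.inr z) = hopfArm2 (.inl z) := by
  ext1
  funext i
  rw [hopfArm2_inl_apply, hopfArm2]
  exact planeEdge_eq_imag _ _

theorem measurable_hopfArm2_inl {n : ℕ} :
    Measurable fun z : Sphere2 (ComplexSpace n) => hopfArm2 (.inl z) := by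
  refine Continuous.measurable (Topology.IsInducing.subtypeVal.continuous_iff.2
    (continuous_pi fun i => ?_))
  have h : Continuous fun z : Sphere2 (ComplexSpace n) => z.1 i :=
    (PiLp.continuous_apply 2 _ i).comp continuous_subtype_val
  simp only [Function.comp_apply, hopfArm2_inl_apply]
  exact continuous_planeEdge_comp (Complex.continuous_re.comp h) (Complex.continuous_im.comp h)

theorem continuous_orbitFrame {𝕜 : Type} [RCLike 𝕜] {n : ℕ} (hn : 2 ≤ n) :
    Continuous (orbitFrame hn : U 𝕜 n → Stiefel 𝕜 n) := by
  have h (j : Fin n) : Continuous fun g : U 𝕜 n => column g j :=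
    (PiLp.continuous_toLp 2 _).comp (continuous_pi fun i => continuous_entry i j)
  exact ((h _).prodMk (h _)).subtype_mk _

instance {𝕜 : Type} [RCLike 𝕜] {n : ℕ} (hn : 2 ≤ n) :
    IsProbabilityMeasure (stiefelMeasure 𝕜 hn) :=
  Measure.isProbabilityMeasure_map (continuous_orbitFrame hn).aemeasurable

theorem continuous_stiefel_fst {𝕜 : Type} [RCLike 𝕜] {n : ℕ} (i : Fin n) :
    Continuous fun p : Stiefel 𝕜 n => p.1.1 i :=
  (PiLp.continuous_apply 2 _ i).comp (continuous_fst.comp continuous_subtype_val)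

theorem continuous_stiefel_snd {𝕜 : Type} [RCLike 𝕜] {n : ℕ} (i : Fin n) :
    Continuous fun p : Stiefel 𝕜 n => p.1.2 i :=
  (PiLp.continuous_apply 2 _ i).comp (continuous_snd.comp continuous_subtype_val)

theorem continuous_imVec_hopf_pairQuat {X : Type*} [TopologicalSpace X] {f g : X → ℂ}
    (hf : Continuous f) (hg : Continuous g) :
    Continuous fun x => imVec (hopf (pairQuat (f x) (g x))) := by
  simp only [imVec_hopf_pairQuat]
  refine (PiLp.continuous_toLp 2 _).comp (continuous_pi fun i => ?_)
  fin_cases i <;> simp <;> fun_prop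

theorem measurable_hopfPol3 {n : ℕ} : Measurable (hopfPol3 (n := n)) := by
  refine Continuous.measurable (Continuous.subtype_mk (continuous_pi fun i => ?_) _)
  exact continuous_imVec_hopf_pairQuat (continuous_stiefel_fst i) (continuous_stiefel_snd i)

theorem hopfPol2_inl_apply {n : ℕ} (p : Stiefel ℝ n) (i : Fin n) :
    (hopfPol2 (.inl p)).1 i = planeEdge (p.1.1 i) (p.1.2 i) := by
  rw [hopfPol2, planeEdge]

theorem hopfPol2_inr {n : ℕ} (p : Stiefel ℝ n) : hopfPol2 (.inr p) = hopfPol2 (.inl p) := by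
  ext1
  funext i
  rw [hopfPol2_inl_apply, hopfPol2]
  exact planeEdge_eq_imag _ _

theorem measurable_hopfPol2_inl {n : ℕ} :
    Measurable fun p : Stiefel ℝ n => hopfPol2 (.inl p) := by
  refine Continuous.measurable (Topology.IsInducing.subtypeVal.continuous_iff.2
    (continuous_pi fun i => ?_))
  simp only [Function.comp_apply, hopfPol2_inl_apply]
  exact continuous_planeEdge_comp (continuous_stiefel_fst i) (continuous_stiefel_snd i)

theorem symArm2_eq (n : ℕ) : symArm2 n =
    (sphereMeasure (ComplexSpace n)).map fun z => hopfArm2 (.inl z) :=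
  map_twoCopies measurable_hopfArm2_inl (fun _ => rfl) hopfArm2_inr

theorem symPol2_eq {n : ℕ} (hn : 2 ≤ n) : symPol2 hn =
    (stiefelMeasure ℝ hn).map fun p => hopfPol2 (.inl p) :=
  map_twoCopies measurable_hopfPol2_inl (fun _ => rfl) hopfPol2_inr

theorem integral_chord_symArm3 {n k : ℕ} (hn : 1 ≤ n) (hk : k ≤ n) :
    Integrable (fun P => chord k P.1) (symArm3 n) ∧
      ∫ P, chord k P.1 ∂(symArm3 n) = 6 * (k : ℝ) / ((n : ℝ) * ((n : ℝ) + 1 / 2)) := by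
  -- A nonzero `n` makes the ambient space nontrivial, so that the sphere measure is a probability.
  have : NeZero n := ⟨by omega⟩
  have hprob : IsProbabilityMeasure ((sphereMeasure (QuatSpace n)).map
      ((↑) : Sphere2 (QuatSpace n) → QuatSpace n)) :=
    Measure.isProbabilityMeasure_map measurable_subtype_coe.aemeasurable
  have hprob' : IsProbabilityMeasure (symArm3 n) :=
    Measure.isProbabilityMeasure_map measurable_hopfArm3.aemeasurable
  refine ⟨integrable_chord k (fun _ h => h) _, ?_⟩
  have h := isRotationInvariant_sphereMeasure.integral_chord_comp (ν :=
    (sphereMeasure (QuatSpace n)).map ((↑) : Sphere2 (QuatSpace n) → QuatSpace n))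
    continuous_imVec_hopf norm_imVec_hopf leftMulJ imVec_hopf_leftMulJ hk
  have hc : Continuous fun x : QuatSpace n => chord k fun i => imVec (hopf (x i)) :=
    (continuous_chord k).comp (continuous_pi fun i =>
      continuous_imVec_hopf.comp (PiLp.continuous_apply 2 _ i))
  rw [integral_map measurable_subtype_coe.aemeasurable hc.aestronglyMeasurable,
    Quaternion.finrank_eq_four] at h
  rw [symArm3, integral_chord_map k measurable_hopfArm3]
  refine h.trans ?_
  have h4 : (√2 : ℝ) ^ 4 = 4 := by
    rw [show (4 : ℕ) = 2 * 2 from rfl, pow_mul, Real.sq_sqrt zero_le_two]; norm_num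
  have hn' : (0 : ℝ) < n := by exact_mod_cast hn
  -- With `r⁴ = 4` and dimension 4 per edge: `4 · 24 / (4n (4n + 2)) = 6 / (n (n + 1/2))`.
  rw [h4]
  push_cast
  field_simp
  ring

theorem integral_chord_symArm2 {n k : ℕ} (hn : 1 ≤ n) (hk : k ≤ n) :
    Integrable (fun P => chord k P.1) (symArm2 n) ∧
      ∫ P, chord k P.1 ∂(symArm2 n) = 8 * (k : ℝ) / ((n : ℝ) * ((n : ℝ) + 1)) := by
  have : NeZero n := ⟨by omega⟩
  have hprob : IsProbabilityMeasure ((sphereMeasure (ComplexSpace n)).map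
      ((↑) : Sphere2 (ComplexSpace n) → ComplexSpace n)) :=
    Measure.isProbabilityMeasure_map measurable_subtype_coe.aemeasurable
  rw [symArm2_eq]
  refine ⟨integrable_chord k (fun _ h => h) _, ?_⟩
  have hf : Continuous fun z : ℂ => planeEdge z.re z.im :=
    continuous_planeEdge_comp Complex.continuous_re Complex.continuous_im
  have h := isRotationInvariant_sphereMeasure.integral_chord_comp (ν :=
    (sphereMeasure (ComplexSpace n)).map ((↑) : Sphere2 (ComplexSpace n) → ComplexSpace n)) hf
    (fun z => by rw [norm_planeEdge, ← Complex.normSq_eq_norm_sq, Complex.normSq_apply]; ring)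
    mulI planeEdge_mulI hk
  have hc : Continuous fun x : ComplexSpace n => chord k fun i => planeEdge (x i).re (x i).im :=
    (continuous_chord k).comp (continuous_pi fun i => hf.comp (PiLp.continuous_apply 2 _ i))
  rw [integral_map measurable_subtype_coe.aemeasurable hc.aestronglyMeasurable,
    Complex.finrank_real_complex] at h
  rw [integral_chord_map k measurable_hopfArm2_inl]
  simp_rw [← hopfArm2_inl_apply] at h
  refine h.trans ?_
  have h4 : (√2 : ℝ) ^ 4 = 4 := by
    rw [show (4 : ℕ) = 2 * 2 from rfl, pow_mul, Real.sq_sqrt zero_le_two]; norm_num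
  have hn' : (0 : ℝ) < n := by exact_mod_cast hn
  -- With dimension 2 per edge: `4 · 8 / (2n (2n + 2)) = 8 / (n (n + 1))`.
  rw [h4]
  push_cast
  field_simp
  ring

theorem integral_chord_symPol3 {n k : ℕ} (hn : 2 ≤ n) (hk : k ≤ n) :
    Integrable (fun P => chord k P.1) (symPol3 hn) ∧
      ∫ P, chord k P.1 ∂(symPol3 hn) =
        (((n : ℝ) - k) / ((n : ℝ) - 1)) * (6 * (k : ℝ) / ((n : ℝ) * ((n : ℝ) + 1))) := by
  have hprob : IsProbabilityMeasure (symPol3 hn) :=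
    Measure.isProbabilityMeasure_map measurable_hopfPol3.aemeasurable
  refine ⟨integrable_chord k (fun _ h => h.1) _, ?_⟩
  have hfr := (continuous_orbitFrame (𝕜 := ℂ) hn).measurable
  rw [symPol3, stiefelMeasure, Measure.map_map measurable_hopfPol3 hfr,
    integral_chord_map k (measurable_hopfPol3.comp hfr)]
  have h01 : (⟨0, by omega⟩ : Fin n) ≠ ⟨1, by omega⟩ := by simp
  refine (integral_chord_haarU hn (f := fun a b => imVec (hopf (pairQuat a b)))
    (continuous_imVec_hopf_pairQuat continuous_fst continuous_snd)
    (fun a b => by rw [norm_imVec_hopf, norm_sq_pairQuat])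
    (fun g => (hopfPol3 (orbitFrame hn g)).2.2) (M := 6 / (n * (n + 1))) (fun i => ?_) hk).trans
    (by rw [mul_div_assoc']; ring)
  have hprob : IsProbabilityMeasure ((haarU ℂ n).map (row i)) :=
    Measure.isProbabilityMeasure_map (continuous_row i).aemeasurable
  -- Two of `n` complex coordinates on the unit sphere: `M = 2 · 3 / (n (n + 1))`.
  have h := (isRotationInvariant_row (𝕜 := ℂ) i).integral_sum_sq_complex
    (EuclideanSpace.basisFun (Fin n) ℂ) {⟨0, by omega⟩, ⟨1, by omega⟩} (by simp)
  simp only [Finset.sum_pair h01, Finset.card_pair h01, EuclideanSpace.basisFun_inner] at h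
  rw [h, Fintype.card_fin]
  norm_num

theorem integral_chord_symPol2 {n k : ℕ} (hn : 2 ≤ n) (hk : k ≤ n) :
    Integrable (fun P => chord k P.1) (symPol2 hn) ∧
      ∫ P, chord k P.1 ∂(symPol2 hn) =
        (((n : ℝ) - k) / ((n : ℝ) - 1)) * (8 * (k : ℝ) / ((n : ℝ) * ((n : ℝ) + 2))) := by
  rw [symPol2_eq]
  refine ⟨integrable_chord k (fun _ h => h.1) _, ?_⟩
  have hfr := (continuous_orbitFrame (𝕜 := ℝ) hn).measurable
  rw [stiefelMeasure, Measure.map_map measurable_hopfPol2_inl hfr,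
    integral_chord_map k (measurable_hopfPol2_inl.comp hfr)]
  have h01 : (⟨0, by omega⟩ : Fin n) ≠ ⟨1, by omega⟩ := by simp
  refine (integral_chord_haarU hn (f := planeEdge)
    (continuous_planeEdge_comp continuous_fst continuous_snd) (fun a b => by simp [norm_planeEdge])
    (fun g => (hopfPol2 (.inl (orbitFrame hn g))).2.2) (M := 8 / (n * (n + 2)))
    (fun i => ?_) hk).trans (by rw [mul_div_assoc']; ring)
  have hprob : IsProbabilityMeasure ((haarU ℝ n).map (row i)) :=
    Measure.isProbabilityMeasure_map (continuous_row i).aemeasurable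
  -- Two of `n` real coordinates on the unit sphere: `M = 2 · 4 / (n (n + 2))`.
  have h := (isRotationInvariant_row (𝕜 := ℝ) i).integral_sum_sq_real
    (EuclideanSpace.basisFun (Fin n) ℝ) {⟨0, by omega⟩, ⟨1, by omega⟩} (by simp)
  simp only [Finset.sum_pair h01, Finset.card_pair h01, EuclideanSpace.basisFun_inner] at h
  simp only [Real.norm_eq_abs, sq_abs]
  rw [h, Fintype.card_fin]
  norm_num

end RandomPolygon

end

/-- Expected squared lengths of the chords that skip the first `k` edges of a random `n`-edge
polygon of total length `2`, under the symmetric measures. -/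
theorem proposition7p1 :
    (∀ n k : ℕ, 1 ≤ n → k ≤ n →
      (Integrable (fun P => chord k P.1) (symArm3 n) ∧
        ∫ P, chord k P.1 ∂(symArm3 n) = 6 * (k : ℝ) / ((n : ℝ) * ((n : ℝ) + 1 / 2))) ∧
      (Integrable (fun P => chord k P.1) (symArm2 n) ∧
        ∫ P, chord k P.1 ∂(symArm2 n) = 8 * (k : ℝ) / ((n : ℝ) * ((n : ℝ) + 1)))) ∧
    (∀ (n k : ℕ) (hn : 2 ≤ n), k ≤ n →
      (Integrable (fun P => chord k P.1) (symPol3 hn) ∧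
        ∫ P, chord k P.1 ∂(symPol3 hn) =
          (((n : ℝ) - k) / ((n : ℝ) - 1)) * (6 * (k : ℝ) / ((n : ℝ) * ((n : ℝ) + 1)))) ∧
      (Integrable (fun P => chord k P.1) (symPol2 hn) ∧
        ∫ P, chord k P.1 ∂(symPol2 hn) =
          (((n : ℝ) - k) / ((n : ℝ) - 1)) * (8 * (k : ℝ) / ((n : ℝ) * ((n : ℝ) + 2))))) := by
  exact ⟨fun n k hn hk => ⟨integral_chord_symArm3 hn hk, integral_chord_symArm2 hn hk⟩,
    fun n k hn hk => ⟨integral_chord_symPol3 hn hk, integral_chord_symPol2 hn hk⟩⟩
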